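/- Let $\Omega$ be a set and let $G\leqslant\operatorname{Sym}(\Omega)$ be a finite transitive permutation group on $\Omega$. Denote by $d(G)$ the minimum number of generators of $G$, and by $\operatorname{Aut}_{\mathrm{perm}}(G)\leqslant\operatorname{Aut}(G)$ the group of all automorphisms of $G$ that are induced through conjugation by some element of the normaliser $\operatorname{N}_{\operatorname{Sym}(\Omega)}(G)$. For integers $d\geqslant 0$ and $n\geqslant 1$, set \[ \mathfrak{f}(d,n):=16^{(n+1)d}\cdot n^{2n^3d^2(5+d+4n^3\log_2 n)+2n^3+4nd+4d}. \] Then \[ |G|\leqslant\mathfrak{f}\bigl(d(G),|\operatorname{Aut}_{\mathrm{perm}}(G)|\bigr). \] -/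

import Mathlib

namespace Equiv.Perm

/-- `Aut_perm(G)`: the automorphisms of the permutation group `G ≤ Sym(Ω)` that are induced
through conjugation by an element of the normaliser of `G` in `Sym(Ω)`, as a subgroup of
`Aut(G)`. -/
def autPerm {Ω : Type*} (G : Subgroup (Equiv.Perm Ω)) : Subgroup (MulAut G) :=
  G.normalizerMonoidHom.range

end Equiv.Perm

/-- The function
`𝔣(d, n) = 16 ^ ((n+1)d) * n ^ (2n³d²(5 + d + 4n³ log₂ n) + 2n³ + 4nd + 4d)`.
The second exponent is a real number because of the logarithm, so the value is taken in `ℝ`. -/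
noncomputable def orderBound (d n : ℕ) : ℝ :=
  (16 : ℝ) ^ ((n + 1) * d) *
    (n : ℝ) ^ (2 * (n : ℝ) ^ 3 * (d : ℝ) ^ 2 * (5 + (d : ℝ) + 4 * (n : ℝ) ^ 3 * Real.logb 2 n)
      + 2 * (n : ℝ) ^ 3 + 4 * (n : ℝ) * (d : ℝ) + 4 * (d : ℝ))

/-!
Let `n = |Aut_perm(G)|`. The inner automorphisms lie in `Aut_perm(G)`, so `Z(G)` has index `m ≤ n`,
and Schur's theorem bounds `|G'|` in terms of `m`. A point stabiliser `H` meets `Z(G)` trivially,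
so `|H| ≤ m`, and it remains to bound the abelian group `B = G / G'H`, which is generated by `d(G)`
elements, through its exponent `e`. Choose `x ∈ G` mapping to an element of order `e` of `B`. A
suitable power of `x` has order exactly `e`, and its `m`-th power `w = x ^ D` is central of order
`q ≥ e / m`. For every `k` there is a homomorphism `φ : G → B → ⟨w⟩` with `φ x = w ^ k`, because a
faithful character of the cyclic group generated by the image of `x` extends to `B`, where it still
takes values in the `e`-th roots of unity. As `φ w = w ^ (D * k)`, the map `g ↦ g * φ g` is an
automorphism as soon as `1 + D * k` is prime to `q`, which happens for at least
`totient q ≥ √(q / 2)` residues `k` modulo `q`. These automorphisms fix `H` pointwise, and by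
transitivity every such automorphism belongs to `Aut_perm(G)`. Hence `e ≤ 2 * m * n ^ 2`.
-/

open Subgroup MulAction
open scoped commutatorElement Pointwise

theorem le_totient_sq_of_odd {q : ℕ} (hq : Odd q) : q ≤ q.totient ^ 2 := by
  induction q using Nat.recOnPosPrimePosCoprime with
  | zero => simp
  | one => simp
  | prime_pow p k hp hk =>
    have hp_odd : Odd p := (Nat.odd_pow_iff hk.ne').1 hq
    have hp_three : 3 ≤ p := hp.two_le.lt_of_ne (by rintro rfl; contradiction)
    have hp_le : p ≤ (p - 1) ^ 2 := by
      obtain ⟨r, rfl⟩ := Nat.exists_eq_add_of_le' hp_three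
      simp only [Nat.add_succ_sub_one]
      nlinarith
    calc p ^ k = p ^ (k - 1) * p := (pow_sub_one_mul hk.ne' p).symm
      _ ≤ (p ^ (k - 1)) ^ 2 * (p - 1) ^ 2 :=
        Nat.mul_le_mul (Nat.le_self_pow two_ne_zero _) hp_le
      _ = (p ^ k).totient ^ 2 := by rw [Nat.totient_prime_pow hp hk, mul_pow]
  | coprime a b _ _ hab iha ihb =>
    rw [Nat.odd_mul] at hq
    rw [Nat.totient_mul hab, mul_pow]
    exact Nat.mul_le_mul (iha hq.1) (ihb hq.2)

theorem le_two_mul_totient_sq (q : ℕ) : q ≤ 2 * q.totient ^ 2 := by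
  rcases eq_or_ne q 0 with rfl | hq
  · exact Nat.zero_le _
  obtain ⟨k, r, hr, rfl⟩ := Nat.exists_eq_two_pow_mul_odd hq
  have hr_le := le_totient_sq_of_odd hr
  cases k with
  | zero => simp only [pow_zero, one_mul]; lia
  | succ j =>
    have htotient : (2 ^ (j + 1) * r).totient = 2 ^ j * r.totient := by
      rw [Nat.totient_mul ((Nat.coprime_two_left.2 hr).pow_left _),
        Nat.totient_prime_pow_succ Nat.prime_two, Nat.add_one_sub_one, mul_one]
    calc 2 ^ (j + 1) * r = 2 * (2 ^ j * r) := by ring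
      _ ≤ 2 * ((2 ^ j) ^ 2 * r.totient ^ 2) :=
        Nat.mul_le_mul_left _ (Nat.mul_le_mul (Nat.le_self_pow two_ne_zero _) hr_le)
      _ = 2 * (2 ^ (j + 1) * r).totient ^ 2 := by rw [htotient, mul_pow]

theorem totient_le_card_ker_unitsMap {D q : ℕ} (hD : D ≠ 0) (hq : q ≠ 0) :
    q.totient ≤ Nat.card (ZMod.unitsMap (D.dvd_mul_right q)).ker := by
  have : NeZero D := ⟨hD⟩
  have : NeZero (D * q) := ⟨mul_ne_zero hD hq⟩
  set f := ZMod.unitsMap (D.dvd_mul_right q)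
  have card_ker_mul : Nat.card f.ker * D.totient = (D * q).totient := by
    rw [← ZMod.card_units_eq_totient, ← ZMod.card_units_eq_totient, ← Nat.card_eq_fintype_card,
      ← Nat.card_eq_fintype_card, ← f.ker.card_mul_index, index_ker,
      MonoidHom.range_eq_top.2 (ZMod.unitsMap_surjective _), card_top]
  have hmul := Nat.totient_super_multiplicative D q
  rw [← card_ker_mul, mul_comm] at hmul
  exact Nat.le_of_mul_le_mul_right hmul (Nat.totient_pos.2 (Nat.pos_of_ne_zero hD))

theorem totient_le_card_filter_coprime_one_add_mul {D q : ℕ} (hD : D ≠ 0) (hq : q ≠ 0) :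
    q.totient ≤ ((Finset.range q).filter fun k => q.Coprime (1 + D * k)).card := by
  have : NeZero D := ⟨hD⟩
  have : NeZero q := ⟨hq⟩
  have exists_eq_one_add_mul : ∀ v : (ZMod.unitsMap (D.dvd_mul_right q)).ker,
      ∃ k < q, ((v : (ZMod (D * q))ˣ) : ZMod (D * q)) = (1 + D * k : ℕ) := by
    rintro ⟨v, hv⟩
    set r := ((v : ZMod (D * q)) - 1).val
    have hv_eq : (v : ZMod (D * q)) = (1 + r : ℕ) := by simp [r]
    obtain ⟨k, hk⟩ : D ∣ r := by
      have hcast : ((1 + r : ℕ) : ZMod D) = 1 := by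
        rw [← ZMod.cast_natCast (D.dvd_mul_right q), ← hv_eq,
          ← ZMod.unitsMap_val (D.dvd_mul_right q), MonoidHom.mem_ker.1 hv, Units.val_one]
      rwa [Nat.cast_add, Nat.cast_one, add_eq_left, ZMod.natCast_eq_zero_iff] at hcast
    refine ⟨k, Nat.lt_of_mul_lt_mul_left (a := D) ?_, by rw [hv_eq, hk]⟩
    exact hk ▸ ZMod.val_lt _
  choose k hk_lt hk using exists_eq_one_add_mul
  have hk_coprime : ∀ v, q.Coprime (1 + D * k v) := fun v => by
    have hunit : IsUnit ((1 + D * k v : ℕ) : ZMod (D * q)) := hk v ▸ Units.isUnit _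
    exact ((ZMod.isUnit_iff_coprime _ _).1 hunit).symm.coprime_dvd_left (dvd_mul_left q D)
  have hk_injective : Function.Injective k := fun v w hvw =>
    Subtype.ext (Units.ext (by rw [hk, hk, hvw]))
  calc q.totient ≤ Nat.card (ZMod.unitsMap (D.dvd_mul_right q)).ker :=
        totient_le_card_ker_unitsMap hD hq
    _ ≤ Nat.card ((Finset.range q).filter fun k => q.Coprime (1 + D * k)) :=
        Nat.card_le_card_of_injective
          (fun v => ⟨k v, Finset.mem_filter.2 ⟨Finset.mem_range.2 (hk_lt v), hk_coprime v⟩⟩)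
          fun v w hvw => hk_injective (congrArg Subtype.val hvw)
    _ = _ := by rw [Nat.card_eq_fintype_card, Fintype.card_coe]

theorem exists_monoidHom_zpowers_apply_eq {A C : Type*} [Group A] [Group C] {x : A} {y : C}
    (hxy : orderOf y ∣ orderOf x) : ∃ φ : zpowers x →* C, φ ⟨x, mem_zpowers x⟩ = y := by
  have hgen : ∀ a : zpowers x, a ∈ zpowers (⟨x, mem_zpowers x⟩ : zpowers x) := by
    rintro ⟨_, k, rfl⟩
    exact ⟨k, Subtype.ext (coe_zpow _ _ _)⟩
  exact ⟨monoidHomOfForallMemZpowers hgen (by rwa [Subgroup.orderOf_mk]),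
    monoidHomOfForallMemZpowers_apply_gen _ _⟩

theorem exists_monoidHom_apply_eq_of_orderOf_eq_exponent {B C : Type*} [CommGroup B] [Finite B]
    [Group C] {x : B} (hx : orderOf x = Monoid.exponent B) {y : C}
    (hy : orderOf y ∣ Monoid.exponent B) : ∃ φ : B →* C, φ x = y := by
  obtain ⟨ζ, hζ⟩ : ∃ ζ : ℂˣ, IsPrimitiveRoot ζ (Monoid.exponent B) := by
    obtain ⟨ζ, hζ⟩ := HasEnoughRootsOfUnity.exists_primitiveRoot ℂ (Monoid.exponent B)
    obtain ⟨ζ, rfl⟩ := hζ.isUnit (NeZero.ne _)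
    exact ⟨ζ, IsPrimitiveRoot.coe_units_iff.1 hζ⟩
  have hζ_order : orderOf ζ = Monoid.exponent B := hζ.eq_orderOf.symm
  obtain ⟨χ₀, hχ₀⟩ := exists_monoidHom_zpowers_apply_eq (hx ▸ hζ_order.dvd : orderOf ζ ∣ orderOf x)
  obtain ⟨χ, rfl⟩ := MonoidHom.domRestrict_surjective ℂ (zpowers x) χ₀
  have hχ_mem (b : B) : χ b ∈ zpowers ζ := by
    rw [hζ.zpowers_eq, mem_rootsOfUnity, ← map_pow, Monoid.pow_exponent_eq_one, map_one]
  obtain ⟨ψ, hψ⟩ := exists_monoidHom_zpowers_apply_eq (hζ_order ▸ hy : orderOf y ∣ orderOf ζ)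
  refine ⟨ψ.comp (χ.codRestrict _ hχ_mem), ?_⟩
  have hχx : χ.codRestrict _ hχ_mem x = ⟨ζ, mem_zpowers ζ⟩ := Subtype.ext hχ₀
  rw [MonoidHom.comp_apply, hχx, hψ]

/-- The central automorphism `g ↦ g * φ g` of a finite group attached to a homomorphism `φ` into
the centre. -/
noncomputable def centralAut {G : Type*} [Group G] [Finite G] (φ : G →* center G)
    (hφ : ∀ g, g * φ g = 1 → g = 1) : MulAut G :=
  MulEquiv.ofBijective
    (MonoidHom.mk' (fun g => g * φ g) fun a b => by
      have hcomm := mem_center_iff.1 (φ a).2 b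
      rw [map_mul, coe_mul, mul_assoc, mul_assoc, ← mul_assoc b, hcomm, mul_assoc])
    (Finite.injective_iff_bijective.1 ((injective_iff_map_eq_one _).2 hφ))

@[simp]
theorem centralAut_apply {G : Type*} [Group G] [Finite G] (φ : G →* center G)
    (hφ : ∀ g, g * φ g = 1 → g = 1) (g : G) : centralAut φ hφ g = g * φ g := rfl

section

variable {G B : Type*} [Group G] [Finite G] [CommGroup B]

theorem exists_mem_fixingSubgroup_ker_apply_eq_mul_pow [Finite B] (π : G →* B) {x : G} {D k : ℕ}
    (hx : orderOf (π x) = Monoid.exponent B) (hD : x ^ D ∈ center G)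
    (hexp : orderOf (x ^ D) ∣ Monoid.exponent B) (hk : (orderOf (x ^ D)).Coprime (1 + D * k)) :
    ∃ α ∈ fixingSubgroup (MulAut G) (π.ker : Set G), α x = x * (x ^ D) ^ k := by
  set w := x ^ D with hw
  obtain ⟨ψ, hψ⟩ := exists_monoidHom_apply_eq_of_orderOf_eq_exponent hx
    (y := (⟨w, mem_zpowers w⟩ : zpowers w) ^ k)
    ((orderOf_pow_dvd k).trans (by rwa [Subgroup.orderOf_mk]))
  let φ : G →* center G := (inclusion (zpowers_le.2 hD)).comp (ψ.comp π)
  have hφx : (φ x : G) = w ^ k := congrArg Subtype.val hψ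
  have hφw : (φ w : G) = w ^ (D * k) := by
    rw [hw, map_pow, coe_pow, hφx, ← pow_mul, mul_comm, ← hw]
  have hφ : ∀ g, g * φ g = 1 → g = 1 := by
    intro g hg
    obtain ⟨j, rfl⟩ : g ∈ zpowers w := by
      rw [eq_inv_of_mul_eq_one_left hg]
      exact inv_mem (ψ (π g)).2
    have hpow : (w ^ j) ^ (1 + D * k) = 1 := by
      rw [pow_add, pow_one, ← zpow_natCast, zpow_comm, zpow_natCast, ← hφw, ← coe_zpow,
        ← map_zpow, hg]
    have horder : orderOf (w ^ j) = 1 := Nat.eq_one_of_dvd_coprimes hk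
      (orderOf_dvd_of_mem_zpowers (zpow_mem_zpowers w j)) (orderOf_dvd_of_pow_eq_one hpow)
    exact orderOf_eq_one_iff.1 horder
  refine ⟨centralAut φ hφ, (mem_fixingSubgroup_iff _).2 fun g hg => ?_, ?_⟩
  · have hφg : φ g = 1 := by
      simp only [φ, MonoidHom.comp_apply, MonoidHom.mem_ker.1 hg, map_one]
    rw [MulAut.smul_def, centralAut_apply, hφg, coe_one, mul_one]
  · rw [centralAut_apply, hφx]

theorem totient_orderOf_le_card_fixingSubgroup_ker [Finite B] (π : G →* B) {x : G} {D : ℕ}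
    (hD₀ : D ≠ 0) (hx : orderOf (π x) = Monoid.exponent B) (hD : x ^ D ∈ center G)
    (hexp : orderOf (x ^ D) ∣ Monoid.exponent B) :
    (orderOf (x ^ D)).totient ≤ Nat.card (fixingSubgroup (MulAut G) (π.ker : Set G)) := by
  set S := (Finset.range (orderOf (x ^ D))).filter fun k => (orderOf (x ^ D)).Coprime (1 + D * k)
  have hS : ∀ k : S, ∃ α ∈ fixingSubgroup (MulAut G) (π.ker : Set G), α x = x * (x ^ D) ^ (k : ℕ) :=
    fun k => exists_mem_fixingSubgroup_ker_apply_eq_mul_pow π hx hD hexp (Finset.mem_filter.1 k.2).2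
  choose α hα hαx using hS
  have hα_injective : Function.Injective fun k : S =>
      (⟨α k, hα k⟩ : fixingSubgroup (MulAut G) (π.ker : Set G)) := by
    intro k l hkl
    have hαkl : α k = α l := congrArg Subtype.val hkl
    have hpow : (x ^ D) ^ (k : ℕ) = (x ^ D) ^ (l : ℕ) :=
      mul_left_cancel ((hαx k).symm.trans ((DFunLike.congr_fun hαkl x).trans (hαx l)))
    have lt_orderOf (i : S) : (i : ℕ) < orderOf (x ^ D) :=
      Finset.mem_range.1 (Finset.mem_filter.1 i.2).1
    exact Subtype.ext (pow_injOn_Iio_orderOf (lt_orderOf k) (lt_orderOf l) hpow)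
  calc (orderOf (x ^ D)).totient ≤ S.card :=
        totient_le_card_filter_coprime_one_add_mul hD₀ (orderOf_pos _).ne'
    _ = Nat.card S := by rw [Nat.card_eq_fintype_card, Fintype.card_coe]
    _ ≤ _ := Nat.card_le_card_of_injective _ hα_injective

theorem exponent_le_index_center_mul_card_fixingSubgroup_ker_sq {π : G →* B}
    (hπ : Function.Surjective π) :
    Monoid.exponent B ≤
      (center G).index * (2 * Nat.card (fixingSubgroup (MulAut G) (π.ker : Set G)) ^ 2) := by
  have : Finite B := Finite.of_surjective π hπ
  obtain ⟨b, hb⟩ := Monoid.exists_orderOf_eq_exponent (Monoid.ExponentExists.of_finite (G := B))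
  obtain ⟨x, rfl⟩ := hπ b
  set e := Monoid.exponent B
  set m := (center G).index
  have he : e ≠ 0 := Monoid.exponent_ne_zero_of_finite
  have hm : 0 < m := Nat.pos_of_ne_zero FiniteIndex.index_ne_zero
  have he_dvd : e ∣ orderOf x := hb ▸ orderOf_map_dvd π x
  set t := orderOf x / e
  have ht : t ≠ 0 := (Nat.div_pos (Nat.le_of_dvd (orderOf_pos x) he_dvd) (by lia)).ne'
  have hq_mul : orderOf (x ^ (t * m)) * e.gcd m = e := by
    rw [pow_mul, orderOf_pow, orderOf_pow_orderOf_div (orderOf_pos x).ne' he_dvd,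
      Nat.div_mul_cancel (Nat.gcd_dvd_left e m)]
  have hcenter : x ^ (t * m) ∈ center G := pow_mul x t m ▸ (center G).pow_index_mem _
  have htotient := totient_orderOf_le_card_fixingSubgroup_ker π (mul_ne_zero ht hm.ne') hb hcenter
    (Dvd.intro _ hq_mul)
  calc e = e.gcd m * orderOf (x ^ (t * m)) := by rw [mul_comm, hq_mul]
    _ ≤ m * orderOf (x ^ (t * m)) := Nat.mul_le_mul_right _ (Nat.gcd_le_right e hm)
    _ ≤ m * (2 * (orderOf (x ^ (t * m))).totient ^ 2) :=
        Nat.mul_le_mul_left _ (le_two_mul_totient_sq _)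
    _ ≤ _ := by gcongr

end

section

variable {G : Type*} [Group G]

theorem commutatorElement_mul_left_of_mem_center {z : G} (hz : z ∈ center G) (a b : G) :
    ⁅a * z, b⁆ = ⁅a, b⁆ := by
  have hzb : ⁅z, b⁆ = 1 := commutatorElement_eq_one_iff_mul_comm.2 (mem_center_iff.1 hz b).symm
  rw [commutatorElement_mul_left_eq_conj_mul, hzb, mul_one, mul_inv_cancel, one_mul]

theorem commutatorElement_mul_right_of_mem_center {z : G} (hz : z ∈ center G) (a b : G) :
    ⁅a, b * z⁆ = ⁅a, b⁆ := by
  rw [← commutatorElement_inv, commutatorElement_mul_left_of_mem_center hz, commutatorElement_inv]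

theorem exists_surjective_commutatorSet (G : Type*) [Group G] :
    ∃ f : (G ⧸ center G) × (G ⧸ center G) → commutatorSet G, Function.Surjective f := by
  refine ⟨fun p => ⟨⁅p.1.out, p.2.out⁆, commutator_mem_commutatorSet _ _⟩, ?_⟩
  rintro ⟨_, a, b, rfl⟩
  obtain ⟨s, hs⟩ := QuotientGroup.mk_out_eq_mul (center G) a
  obtain ⟨t, ht⟩ := QuotientGroup.mk_out_eq_mul (center G) b
  refine ⟨(a, b), Subtype.ext ?_⟩
  dsimp only
  rw [hs, ht, commutatorElement_mul_left_of_mem_center s.2,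
    commutatorElement_mul_right_of_mem_center t.2]

theorem card_commutator_le_index_center_pow (G : Type*) [Group G] [FiniteIndex (center G)] :
    Nat.card (commutator G) ≤ (center G).index ^ ((center G).index ^ 3 + 1) := by
  have hindex : 0 < (center G).index := Nat.pos_of_ne_zero FiniteIndex.index_ne_zero
  obtain ⟨f, hf⟩ := exists_surjective_commutatorSet G
  have : Finite (commutatorSet G) := Finite.of_surjective f hf
  have hcommutatorSet : Nat.card (commutatorSet G) ≤ (center G).index ^ 2 := by
    rw [sq, index_eq_card, ← Nat.card_prod]
    exact Nat.card_le_card_of_surjective f hf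
  calc Nat.card (commutator G)
      ≤ (center G).index ^ ((center G).index * Nat.card (commutatorSet G) + 1) :=
        Nat.le_of_dvd (pow_pos hindex _) (card_commutator_dvd_index_center_pow G)
    _ ≤ (center G).index ^ ((center G).index * (center G).index ^ 2 + 1) := by gcongr
    _ = (center G).index ^ ((center G).index ^ 3 + 1) := by rw [← pow_succ']

/-- The projection of `G` onto `G / G'H`, its largest abelian quotient in which `H` dies. -/
def abelianQuotientHom (H : Subgroup G) : G →* Abelianization G ⧸ H.map Abelianization.of :=
  (QuotientGroup.mk' (H.map Abelianization.of)).comp Abelianization.of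

theorem abelianQuotientHom_surjective (H : Subgroup G) :
    Function.Surjective (abelianQuotientHom H) :=
  (QuotientGroup.mk'_surjective _).comp QuotientGroup.mk_surjective

theorem ker_abelianQuotientHom (H : Subgroup G) :
    (abelianQuotientHom H).ker = H ⊔ commutator G := by
  rw [abelianQuotientHom, ← MonoidHom.comap_ker, QuotientGroup.ker_mk', comap_map_eq,
    Abelianization.ker_of]

theorem card_ker_abelianQuotientHom_le (H : Subgroup G) :
    Nat.card (abelianQuotientHom H).ker ≤ Nat.card H * Nat.card (commutator G) := by
  rw [ker_abelianQuotientHom]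
  calc Nat.card (H ⊔ commutator G : Subgroup G)
      = Nat.card ((H : Set G) * (commutator G : Set G) : Set G) := by rw [← mul_normal]; rfl
    _ ≤ Nat.card H * Nat.card (commutator G) := Set.natCard_mul_le

theorem card_le_card_ker_mul_exponent_pow_rank {B : Type*} [Group.FG G] [CommGroup B] [Finite B]
    {π : G →* B} (hπ : Function.Surjective π) :
    Nat.card G ≤ Nat.card π.ker * Monoid.exponent B ^ Group.rank G := by
  have hexp : 0 < Monoid.exponent B := Nat.pos_of_ne_zero Monoid.exponent_ne_zero_of_finite
  calc Nat.card G = Nat.card π.ker * Nat.card B := by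
        rw [← π.ker.card_mul_index, index_ker, MonoidHom.range_eq_top.2 hπ, card_top]
    _ ≤ Nat.card π.ker * Monoid.exponent B ^ Group.rank B :=
        Nat.mul_le_mul_left _ (Nat.le_of_dvd (pow_pos hexp _) (card_dvd_exponent_pow_rank B))
    _ ≤ Nat.card π.ker * Monoid.exponent B ^ Group.rank G :=
        Nat.mul_le_mul_left _ (Nat.pow_le_pow_right hexp (Group.rank_le_of_surjective π hπ))

theorem card_le_card_subgroup_mul_index_center_pow_mul [Finite G] (H : Subgroup G) :
    Nat.card G ≤ Nat.card H * (center G).index ^ ((center G).index ^ 3 + 1) *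
      ((center G).index * (2 * Nat.card (fixingSubgroup (MulAut G) (H : Set G)) ^ 2)) ^
        Group.rank G := by
  have hsurj := abelianQuotientHom_surjective H
  have hle : H ≤ (abelianQuotientHom H).ker := ker_abelianQuotientHom H ▸ le_sup_left
  refine (card_le_card_ker_mul_exponent_pow_rank hsurj).trans ?_
  gcongr
  · exact (card_ker_abelianQuotientHom_le H).trans
      (Nat.mul_le_mul_left _ (card_commutator_le_index_center_pow G))
  · refine (exponent_le_index_center_mul_card_fixingSubgroup_ker_sq hsurj).trans ?_
    gcongr
    exact card_le_of_le (fixingSubgroup_antitone _ _ hle)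

end

section

variable {G X : Type*} [Group G] [MulAction G X] [IsPretransitive G X]

theorem disjoint_stabilizer_center [FaithfulSMul G X] (ω : X) :
    Disjoint (stabilizer G ω) (center G) := by
  refine disjoint_def.2 fun {h} hstab hcenter => eq_of_smul_eq_smul fun w : X => ?_
  obtain ⟨g, rfl⟩ := exists_smul_eq G ω w
  rw [one_smul, ← mul_smul, ← mem_center_iff.1 hcenter g, mul_smul, mem_stabilizer_iff.1 hstab]

theorem card_stabilizer_le_index_center [FiniteIndex (center G)] [FaithfulSMul G X] (ω : X) :
    Nat.card (stabilizer G ω) ≤ (center G).index := by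
  rw [← relIndex_bot_left, ← (disjoint_stabilizer_center (G := G) ω).symm.eq_bot,
    inf_relIndex_right, ← relIndex_top_right]
  exact relIndex_le_of_le_right le_top (by simpa using FiniteIndex.index_ne_zero)

theorem exists_perm_smul_eq_of_mem_fixingSubgroup_stabilizer {ω : X} {α : MulAut G}
    (hα : α ∈ fixingSubgroup (MulAut G) (stabilizer G ω : Set G)) :
    ∃ σ : Equiv.Perm X, ∀ (g : G) (w : X), σ (g • w) = α g • σ w := by
  have apply_eq {h : G} (hh : h ∈ stabilizer G ω) : α h = h := (mem_fixingSubgroup_iff _).1 hα h hh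
  have apply_mem_iff (h : G) : α h ∈ stabilizer G ω ↔ h ∈ stabilizer G ω :=
    ⟨fun hh => α.injective (apply_eq hh) ▸ hh, fun hh => (apply_eq hh).symm ▸ hh⟩
  have smul_eq_iff (g h : G) : α g • ω = α h • ω ↔ g • ω = h • ω := by
    rw [← inv_smul_eq_iff, ← inv_smul_eq_iff, ← mul_smul, ← mul_smul, ← map_inv, ← map_mul]
    exact apply_mem_iff _
  choose s hs using exists_smul_eq G ω
  have apply_s_smul (g : G) : α (s (g • ω)) • ω = α g • ω := (smul_eq_iff _ _).2 (hs _)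
  have bijective : Function.Bijective fun w => α (s w) • ω := by
    refine ⟨fun v w hvw => ?_, fun w => ⟨α.symm (s w) • ω, ?_⟩⟩
    · rw [← hs v, ← hs w]
      exact (smul_eq_iff _ _).1 hvw
    · simp only [apply_s_smul, MulEquiv.apply_symm_apply, hs]
  refine ⟨Equiv.ofBijective _ bijective, fun g w => ?_⟩
  simp only [Equiv.ofBijective_apply]
  rw [← mul_smul, ← map_mul, ← apply_s_smul (g * s w), mul_smul, hs]

end

section

variable {Ω : Type*} {G : Subgroup (Equiv.Perm Ω)}

open Equiv.Perm

theorem mem_autPerm_of_conj_eq {α : MulAut G} {σ : Equiv.Perm Ω}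
    (hσ : ∀ g : G, σ * g * σ⁻¹ = α g) : α ∈ autPerm G := by
  have hnorm : σ ∈ normalizer (G : Set (Equiv.Perm Ω)) := by
    refine mem_normalizer_iff.2 fun g => ⟨fun hg => ?_, fun hg => ?_⟩
    · rw [hσ ⟨g, hg⟩]
      exact (α ⟨g, hg⟩).2
    · obtain ⟨h, hh⟩ := α.surjective ⟨_, hg⟩
      have hconj : σ * h * σ⁻¹ = σ * g * σ⁻¹ := by rw [hσ, hh]
      rw [← mul_left_cancel (mul_right_cancel hconj)]
      exact h.2
  exact ⟨⟨σ, hnorm⟩, MulEquiv.ext fun g => Subtype.ext (hσ g)⟩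

theorem fixingSubgroup_stabilizer_le_autPerm [IsPretransitive G Ω] (ω : Ω) :
    fixingSubgroup (MulAut G) (stabilizer G ω : Set G) ≤ autPerm G := by
  intro α hα
  obtain ⟨σ, hσ⟩ := exists_perm_smul_eq_of_mem_fixingSubgroup_stabilizer hα
  exact mem_autPerm_of_conj_eq fun g => mul_inv_eq_of_eq_mul (Equiv.ext (hσ g))

theorem range_conj_le_autPerm : (MulAut.conj : G →* MulAut G).range ≤ autPerm G := by
  rintro _ ⟨g, rfl⟩
  exact mem_autPerm_of_conj_eq (σ := g) fun _ => rfl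

theorem ker_mulAut_conj (G : Type*) [Group G] : (MulAut.conj : G →* MulAut G).ker = center G := by
  ext g
  rw [MonoidHom.mem_ker, mem_center_iff, MulEquiv.ext_iff]
  refine forall_congr' fun h => ?_
  rw [MulAut.conj_apply, MulAut.one_apply, mul_inv_eq_iff_eq_mul, eq_comm]

theorem index_center_le_card_autPerm [Finite (autPerm G)] :
    (center G).index ≤ Nat.card (autPerm G) := by
  rw [← ker_mulAut_conj, index_ker]
  exact card_le_of_le range_conj_le_autPerm

theorem card_le_card_autPerm_pow_mul [Finite G] [IsPretransitive G Ω] :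
    Nat.card G ≤ Nat.card (autPerm G) ^ (Nat.card (autPerm G) ^ 3 + 2) *
      (2 * Nat.card (autPerm G) ^ 3) ^ Group.rank G := by
  have hindex : (center G).index ≤ Nat.card (autPerm G) := index_center_le_card_autPerm
  have hpos : 0 < Nat.card (autPerm G) := Nat.card_pos
  rcases isEmpty_or_nonempty Ω with hΩ | ⟨⟨ω⟩⟩
  · rw [Nat.card_unique]
    exact Nat.one_le_iff_ne_zero.2 (by positivity)
  have hfix : Nat.card (fixingSubgroup (MulAut G) (stabilizer G ω : Set G)) ≤
      Nat.card (autPerm G) :=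
    card_le_of_le (fixingSubgroup_stabilizer_le_autPerm ω)
  have hstab : Nat.card (stabilizer G ω) ≤ Nat.card (autPerm G) :=
    (card_stabilizer_le_index_center ω).trans hindex
  set n := Nat.card (autPerm G)
  calc Nat.card G ≤ n * n ^ (n ^ 3 + 1) * (n * (2 * n ^ 2)) ^ Group.rank G := by
        refine (card_le_card_subgroup_mul_index_center_pow_mul (stabilizer G ω)).trans ?_
        gcongr
    _ = n ^ (n ^ 3 + 2) * (2 * n ^ 3) ^ Group.rank G := by ring

end

theorem pow_mul_two_mul_pow_le_orderBound (d : ℕ) {n : ℕ} (hn : 1 ≤ n) :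
    ((n ^ (n ^ 3 + 2) * (2 * n ^ 3) ^ d : ℕ) : ℝ) ≤ orderBound d n := by
  have hn' : (1 : ℝ) ≤ n := by exact_mod_cast hn
  have hlog : 0 ≤ Real.logb 2 n := Real.logb_nonneg one_lt_two hn'
  have htwo : (2 : ℝ) ^ d ≤ 16 ^ ((n + 1) * d) :=
    calc (2 : ℝ) ^ d ≤ 16 ^ d := by gcongr; norm_num
      _ ≤ 16 ^ ((n + 1) * d) :=
        pow_le_pow_right₀ (by norm_num) (Nat.le_mul_of_pos_left d n.succ_pos)
  have hpow : (n : ℝ) ^ (n ^ 3 + 2 + 3 * d) ≤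
      (n : ℝ) ^ (2 * (n : ℝ) ^ 3 * (d : ℝ) ^ 2 * (5 + (d : ℝ) + 4 * (n : ℝ) ^ 3 * Real.logb 2 n)
        + 2 * (n : ℝ) ^ 3 + 4 * (n : ℝ) * (d : ℝ) + 4 * (d : ℝ)) := by
    rcases hn.eq_or_lt with rfl | hn_two
    · simp
    rw [← Real.rpow_natCast]
    refine Real.rpow_le_rpow_of_exponent_le hn' ?_
    have hcube : (2 : ℝ) ^ 3 ≤ (n : ℝ) ^ 3 := by gcongr; exact_mod_cast hn_two
    have hquad : 0 ≤ 2 * (n : ℝ) ^ 3 * (d : ℝ) ^ 2 *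
        (5 + (d : ℝ) + 4 * (n : ℝ) ^ 3 * Real.logb 2 n) := by positivity
    have hlin : (0 : ℝ) ≤ n * d := by positivity
    push_cast
    linarith
  calc ((n ^ (n ^ 3 + 2) * (2 * n ^ 3) ^ d : ℕ) : ℝ) = 2 ^ d * (n : ℝ) ^ (n ^ 3 + 2 + 3 * d) := by
        push_cast
        ring
    _ ≤ orderBound d n := mul_le_mul htwo hpow (by positivity) (by positivity)

theorem lemma5p3 {Ω : Type*} (G : Subgroup (Equiv.Perm Ω)) [Finite G]
    [MulAction.IsPretransitive G Ω] :
    (Nat.card G : ℝ) ≤ orderBound (Group.rank G) (Nat.card (Equiv.Perm.autPerm G)) := by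
  refine le_trans ?_ (pow_mul_two_mul_pow_le_orderBound _ Nat.card_pos)
  exact_mod_cast card_le_card_autPerm_pow_mul
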